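/- Let $H_{4,d}$ be the space of real forms of degree $d$ in four variables, $P_{4,4}\subset H_{4,4}$ the cone of nonnegative quartics, $\Sigma_{4,4}\subset P_{4,4}$ the cone of sums of squares of elements of $H_{4,2}$, and $\Sigma_{4,4}^*$ the cone of linear functionals $l:H_{4,4}\to\mathbb R$ with $l(f)\ge 0$ for all $f\in\Sigma_{4,4}$. For a form $f$ let $\mathcal V(f)\subset\mathbb P^3(\mathbb R)$ be its real projective variety. Let $p\in\partial P_{4,4}$ with $p\notin\Sigma_{4,4}$. Let $v_1,\dots,v_8\in\mathbb R^4\setminus\{0\}$ represent eight distinct points of $\mathbb P^3(\mathbb R)$, no five of which lie on a plane, such that $\{[v_1],\dots,[v_8]\}=\mathcal V(q_1)\cap\mathcal V(q_2)\cap\mathcal V(q_3)$ for three coprime quadrics $q_1,q_2,q_3\in H_{4,2}$ (no nonconstant common factor), and such that $\mathcal V(p)=\{[v_1],\dots,[v_k]\}$ for some $1\le k\le 7$. Then there is $u=(u_1,\dots,u_8)\in\mathbb R^8$, unique up to scaling, with $u\neq 0$ and $\sum_{j=1}^8u_jf(v_j)=0$ for all $f\in H_{4,2}$ (the Cayley–Bacharach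 relation), and all $u_j$ are nonzero. If $$(u_{k+1}^2+\dots+u_7^2)\,(p(v_{k+1})+\dots+p(v_7))<u_8^2\,p(v_8)$$ (for $k=7$ the left-hand side is $0$), then there exists $a\in\mathbb R^8$ such that $l_a:H_{4,4}\to\mathbb R$, $l_a(f)=\sum_{j=1}^8a_jf(v_j)$, satisfies $l_a(p)<0$ and spans an extreme ray of $\Sigma_{4,4}^*$; in particular $l_a\ge 0$ on $\Sigma_{4,4}$, so $l_a$ separates $p$ from $\Sigma_{4,4}$. -/

import Mathlib

open MvPolynomial

/-- `Form n d`: the real vector space `H_{n,d}` of homogeneous polynomials of degree `d` in `n`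
variables. -/
abbrev Form (n d : ℕ) : Type := ↥(homogeneousSubmodule (Fin n) ℝ d)

/-- The usual topology of the finite-dimensional space `H_{n,d}`: convergence of coefficients. -/
instance Form.instTopologicalSpace (n d : ℕ) : TopologicalSpace (Form n d) :=
  TopologicalSpace.induced
    (fun (f : Form n d) (m : Fin n →₀ ℕ) => coeff m (f : MvPolynomial (Fin n) ℝ)) inferInstance

/-- Point evaluation `f ↦ f(x)` as a linear functional on `H_{n,d}`. -/
noncomputable def evalAt {n d : ℕ} (x : Fin n → ℝ) : Module.Dual ℝ (Form n d) :=
  (aeval x : MvPolynomial (Fin n) ℝ →ₐ[ℝ] ℝ).toLinearMap.comp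
    (homogeneousSubmodule (Fin n) ℝ d).subtype

theorem evalAt_apply {n d : ℕ} (x : Fin n → ℝ) (f : Form n d) :
    evalAt x f = eval x (f : MvPolynomial (Fin n) ℝ) := rfl

/-- The cone `P_{n,2d}` of nonnegative forms. -/
def psdCone (n d : ℕ) : Set (Form n (2 * d)) :=
  {f | ∀ x : Fin n → ℝ, 0 ≤ evalAt x f}

/-- The cone `Σ_{n,2d}` of finite sums of squares of forms of degree `d`. -/
def sosCone (n d : ℕ) : Set (Form n (2 * d)) :=
  {f | ∃ (r : ℕ) (g : Fin r → Form n d),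
    (f : MvPolynomial (Fin n) ℝ) = ∑ i, (g i : MvPolynomial (Fin n) ℝ) ^ 2}

/-- The dual cone `Σ_{n,2d}^*`: linear functionals that are nonnegative on sums of squares. -/
def dualSosCone (n d : ℕ) : Set (Module.Dual ℝ (Form n (2 * d))) :=
  {l | ∀ f ∈ sosCone n d, 0 ≤ l f}

/-- `l` spans an extreme ray of the convex cone `C`: it is a nonzero element of `C`, and whenever
it is a sum of two elements of `C`, both are nonnegative multiples of `l`. -/
def SpansExtremeRay {E : Type*} [AddCommGroup E] [Module ℝ E] (C : Set E) (l : E) : Prop :=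
  l ∈ C ∧ l ≠ 0 ∧
    ∀ l₁ ∈ C, ∀ l₂ ∈ C, l₁ + l₂ = l →
      (∃ c : ℝ, 0 ≤ c ∧ l₁ = c • l) ∧ (∃ c : ℝ, 0 ≤ c ∧ l₂ = c • l)

/-- The real projective variety of a form: the points of `ℙ(ℝⁿ)` on all of whose
representatives the form vanishes. -/
def realVariety {n d : ℕ} (f : Form n d) : Set (Projectivization ℝ (Fin n → ℝ)) :=
  {P | ∀ x ∈ P.submodule, evalAt x f = 0}

/-- The genericity condition: no five of the eight points lie on a plane of `ℙ³`. -/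
def NoFiveOnPlane (v : Fin 8 → Fin 4 → ℝ) : Prop :=
  ∀ W : Submodule ℝ (Fin 4 → ℝ), Module.finrank ℝ W = 3 → {j | v j ∈ W}.ncard ≤ 4

/-- The forms have no common nonconstant factor. -/
def CoprimeForms {n d : ℕ} {ι : Type*} (q : ι → Form n d) : Prop :=
  ∀ g : MvPolynomial (Fin n) ℝ, (∀ i, g ∣ (q i : MvPolynomial (Fin n) ℝ)) → IsUnit g

/-- `u` is a nontrivial linear relation on the values of quaternary quadrics at the `v j`. -/
def IsCayleyBacharach (v : Fin 8 → Fin 4 → ℝ) (u : Fin 8 → ℝ) : Prop :=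
  u ≠ 0 ∧ ∀ f : Form 4 2, ∑ j, u j * evalAt (v j) f = 0

/-! Take `l_a` with `a_1, …, a_7 > 0 > a_8` and `∑ u_j² / a_j = 0`. On a square `g²` it is the
diagonal form `∑ a_j y_j²` at the values `y_j = g(v_j)`, which fill the hyperplane `∑ u_j y_j = 0`.
The condition on `a` is the equality case of Cauchy–Schwarz: the form is nonnegative on that
hyperplane and degenerate along `y_j = u_j / a_j` (`sum_mul_sq_nonneg`). If `l_a = l₁ + l₂` in the
dual cone, then `l₁` annihilates all multiples of any `f` with `l_a(f²) = 0`. Quadrics through the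
eight points give `l₁ = l_b`; the degenerate direction gives `b_j u_j / a_j = c u_j`, so `b = c a`.
The hypothesis on `p` is exactly what leaves room to choose such `a` with `l_a(p) < 0`.

This needs two facts from geometry, proved over the reals from finiteness of the base locus and the
no-five-coplanar condition. First, the quadrics through the points form a space of dimension three
(`exists_relation`, `relation_ne_zero`). Second, every quartic through the points lies in the ideal
of those quadrics (`ker_evalMap_four_le`); this is a dimension count, 30 - 3 = 35 - 8, once all
syzygies are Koszul. Koszulness rests on transversality: no nonzero quadric through all eight points
is singular at one of them (`eq_zero_of_singular`). -/

instance finiteDimensional_form (n d : ℕ) : FiniteDimensional ℝ (Form n d) :=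
  Module.Finite.iff_fg.mpr (homogeneousSubmodule_fg (Fin n) ℝ d)

theorem finrank_form (n d : ℕ) : Module.finrank ℝ (Form n d) = n.multichoose d := by
  have e : Form n d ≃ₗ[ℝ] ({m : Fin n →₀ ℕ | m.degree = d} →₀ ℝ) :=
    (LinearEquiv.ofEq _ _ (homogeneousSubmodule_eq_finsupp_supported (Fin n) ℝ d)).trans
      (AddMonoidAlgebra.supportedEquivFinsupp _)
  have hs : {m : Fin n →₀ ℕ | m.degree = d}
      = ↑((Finset.univ : Finset (Fin n)).finsuppAntidiag d) := by
    ext m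
    simp [Finset.mem_finsuppAntidiag, Finsupp.degree_eq_sum]
  rw [hs] at e
  rw [e.finrank_eq, Module.finrank_finsupp_self]
  simp [Finset.card_finsuppAntidiag_nat_eq_multichoose]

theorem form_ext {n d : ℕ} {f g : Form n d} (h : ∀ x, evalAt x f = evalAt x g) : f = g :=
  Subtype.ext (MvPolynomial.funext h)

/-! ### Polarization of quadratic forms and products of linear forms. -/

theorem exists_polar {n : ℕ} (f : Form n 2) :
    ∃ B : (Fin n → ℝ) →ₗ[ℝ] (Fin n → ℝ) →ₗ[ℝ] ℝ,
      (∀ x y, B x y = B y x) ∧ ∀ x, evalAt x f = B x x := by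
  obtain ⟨f, hf⟩ := f
  simp only [evalAt_apply]
  have lin : ∀ g ∈ homogeneousSubmodule (Fin n) ℝ 1, 
      ∃ l : Module.Dual ℝ (Fin n → ℝ), ∀ x, eval x g = l x := by
    intro g hg
    rw [homogeneousSubmodule_one_eq_span_X] at hg
    induction hg using Submodule.span_induction with
    | mem g hg => obtain ⟨i, rfl⟩ := hg; exact ⟨LinearMap.proj i, by simp⟩
    | zero => exact ⟨0, by simp⟩
    | add g h _ _ ihg ihh =>
      obtain ⟨l, hl⟩ := ihg
      obtain ⟨m, hm⟩ := ihh
      exact ⟨l + m, by simp [hl, hm]⟩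
    | smul c g _ ih =>
      obtain ⟨l, hl⟩ := ih
      exact ⟨c • l, by simp [hl, smul_eval]⟩
  rw [← homogeneousSubmodule_one_pow, pow_two] at hf
  induction hf using Submodule.mul_induction_on' with
  | mem_mul_mem g hg h hh =>
    obtain ⟨l, hl⟩ := lin g hg
    obtain ⟨m, hm⟩ := lin h hh
    refine ⟨(1 / 2 : ℝ) • (l.smulRight m + m.smulRight l), fun x y => ?_, fun x => ?_⟩
    · simp; ring
    · simp [hl, hm]; ring
  | add g _ h _ ihg ihh =>
    obtain ⟨B, hB, hB'⟩ := ihg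
    obtain ⟨C, hC, hC'⟩ := ihh
    exact ⟨B + C, fun x y => by simp [hB x y, hC x y], fun x => by simp [hB', hC']⟩

theorem exists_linearForm {n : ℕ} (l : Module.Dual ℝ (Fin n → ℝ)) :
    ∃ f : Form n 1, ∀ x, evalAt x f = l x := by
  refine ⟨⟨∑ i, C (l (Pi.single i 1)) * X i, Submodule.sum_mem _ fun i _ => ?_⟩, fun x => ?_⟩
  · simpa using (isHomogeneous_C (Fin n) (l (Pi.single i 1))).mul (isHomogeneous_X ℝ i)
  · rw [LinearMap.pi_apply_eq_sum_univ l x]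
    simp [evalAt_apply, mul_comm]
    refine Finset.sum_congr rfl fun i _ => ?_
    congr 2
    ext j
    simp [Pi.single_apply, eq_comm]

/-- The product of two forms. -/
noncomputable def formMul {n a b : ℕ} : Form n a →ₗ[ℝ] Form n b →ₗ[ℝ] Form n (a + b) :=
  LinearMap.mk₂ ℝ (fun f g => ⟨f * g, IsHomogeneous.mul f.2 g.2⟩)
    (fun f g h => Subtype.ext (by simp [add_mul])) (fun c f g => Subtype.ext (by simp))
    (fun f g h => Subtype.ext (by simp [mul_add])) (fun c f g => Subtype.ext (by simp))

@[simp]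
theorem evalAt_formMul {n a b : ℕ} (f : Form n a) (g : Form n b) (x : Fin n → ℝ) :
    evalAt x (formMul f g) = evalAt x f * evalAt x g := by
  simp [evalAt_apply, formMul]

theorem exists_planePair {n : ℕ} (l m : Module.Dual ℝ (Fin n → ℝ)) :
    ∃ f : Form n 2, ∀ x, evalAt x f = l x * m x := by
  obtain ⟨f, hf⟩ := exists_linearForm l
  obtain ⟨g, hg⟩ := exists_linearForm m
  exact ⟨formMul f g, fun x => by
    rw [← hf, ← hg]
    exact evalAt_formMul f g x⟩

theorem exists_polar_apply {n : ℕ} (f : Form n 2) :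
    ∃ B : (Fin n → ℝ) →ₗ[ℝ] (Fin n → ℝ) →ₗ[ℝ] ℝ,
      ∀ x y, B x y = (evalAt (x + y) f - evalAt x f - evalAt y f) / 2 := by
  obtain ⟨B, hB, hf⟩ := exists_polar f
  refine ⟨B, fun x y => ?_⟩
  simp only [hf, map_add, LinearMap.add_apply, hB y x]
  ring

/-- The symmetric bilinear form attached to a quadratic form. -/
noncomputable def polar {n : ℕ} : Form n 2 →ₗ[ℝ] (Fin n → ℝ) →ₗ[ℝ] (Fin n → ℝ) →ₗ[ℝ] ℝ where
  toFun f := (exists_polar_apply f).choose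
  map_add' f g := LinearMap.ext₂ fun x y => by
    rw [LinearMap.add_apply, LinearMap.add_apply]
    rw [(exists_polar_apply (f + g)).choose_spec, (exists_polar_apply f).choose_spec,
      (exists_polar_apply g).choose_spec]
    simp only [map_add]
    ring
  map_smul' c f := LinearMap.ext₂ fun x y => by
    rw [LinearMap.smul_apply, LinearMap.smul_apply]
    rw [(exists_polar_apply (c • f)).choose_spec, (exists_polar_apply f).choose_spec]
    simp only [map_smul, smul_eq_mul, RingHom.id_apply]
    ring

theorem polar_apply {n : ℕ} (f : Form n 2) (x y : Fin n → ℝ) :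
    polar f x y = (evalAt (x + y) f - evalAt x f - evalAt y f) / 2 :=
  (exists_polar_apply f).choose_spec x y

theorem polar_comm {n : ℕ} (f : Form n 2) (x y : Fin n → ℝ) : polar f x y = polar f y x := by
  rw [polar_apply, polar_apply, add_comm x y]
  ring

theorem polar_self {n : ℕ} (f : Form n 2) (x : Fin n → ℝ) : polar f x x = evalAt x f := by
  obtain ⟨B, hB, hf⟩ := exists_polar f
  rw [polar_apply]
  simp only [hf, map_add, LinearMap.add_apply]
  ring

theorem evalAt_add {n : ℕ} (f : Form n 2) (x y : Fin n → ℝ) :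
    evalAt (x + y) f = evalAt x f + 2 * polar f x y + evalAt y f := by
  rw [polar_apply]
  ring

theorem evalAt_smul {n : ℕ} (f : Form n 2) (c : ℝ) (x : Fin n → ℝ) :
    evalAt (c • x) f = c ^ 2 * evalAt x f := by
  simp only [← polar_self, map_smul, LinearMap.smul_apply, smul_eq_mul]
  ring

/-! ### Linear relations and the range of an evaluation map. -/

theorem exists_relation_of_notMem_range {V ι : Type*} [AddCommGroup V] [Module ℝ V] [Fintype ι]
    (L : V →ₗ[ℝ] ι → ℝ) {y : ι → ℝ} (hy : y ∉ LinearMap.range L) :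
    ∃ w : ι → ℝ, (∀ x, ∑ i, w i * L x i = 0) ∧ ∑ i, w i * y i ≠ 0 := by
  classical
  obtain ⟨φ, hφ, h⟩ := Submodule.exists_dual_map_eq_bot_of_notMem hy inferInstance
  have key : ∀ z, φ z = ∑ i, φ (Pi.single i 1) * z i := by
    intro z
    rw [LinearMap.pi_apply_eq_sum_univ φ z]
    refine Finset.sum_congr rfl fun i _ => ?_
    rw [smul_eq_mul, mul_comm]
    congr 2
    ext j
    simp [Pi.single_apply, eq_comm]
  refine ⟨fun i => φ (Pi.single i 1), fun x => ?_, by rwa [← key]⟩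
  rw [← key, ← Submodule.mem_bot ℝ, ← h]
  exact Submodule.mem_map_of_mem (LinearMap.mem_range_self L x)

theorem surjective_of_forall_relation {V ι : Type*} [AddCommGroup V] [Module ℝ V] [Fintype ι]
    (L : V →ₗ[ℝ] ι → ℝ) (h : ∀ w : ι → ℝ, (∀ x, ∑ i, w i * L x i = 0) → w = 0) :
    LinearMap.range L = ⊤ := by
  refine eq_top_iff.2 fun y _ => ?_
  by_contra hy
  obtain ⟨w, hw, hwy⟩ := exists_relation_of_notMem_range L hy
  simp [h w hw] at hwy

/-! ### Position of the eight points and uniqueness of the relation. -/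

/-- Eight pairwise independent vectors in `ℝ⁴`, no five on a plane, whose lines are the base locus
of the linear system of quadrics through them. -/
structure IsBaseLocus (v : Fin 8 → Fin 4 → ℝ) : Prop where
  indep : ∀ i j, i ≠ j → ∀ a b : ℝ, a • v i + b • v j = 0 → a = 0 ∧ b = 0
  generic : NoFiveOnPlane v
  base : ∀ x, (∀ f : Form 4 2, (∀ j, evalAt (v j) f = 0) → evalAt x f = 0) →
    ∃ j, ∃ c : ℝ, x = c • v j

theorem exists_dual_ne_zero_of_three (x y z : Fin 4 → ℝ) :
    ∃ l : Module.Dual ℝ (Fin 4 → ℝ), l ≠ 0 ∧ l x = 0 ∧ l y = 0 ∧ l z = 0 := by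
  have h : Submodule.span ℝ (Set.range ![x, y, z]) < ⊤ := by
    refine lt_top_iff_ne_top.2 fun h => ?_
    have h1 := finrank_range_le_card (R := ℝ) ![x, y, z]
    rw [Set.finrank, h, finrank_top] at h1
    simp at h1
  obtain ⟨l, hl, h⟩ := Submodule.exists_le_ker_of_lt_top _ h
  have key : ∀ i, l (![x, y, z] i) = 0 := fun i => h (Submodule.subset_span ⟨i, rfl⟩)
  exact ⟨l, hl, key 0, key 1, key 2⟩

namespace IsBaseLocus

variable {v : Fin 8 → Fin 4 → ℝ}

theorem ne_zero (h : IsBaseLocus v) (i : Fin 8) : v i ≠ 0 := by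
  intro hi
  obtain ⟨j, hj⟩ := exists_ne i
  simpa using (h.indep i j hj.symm 1 0 (by simp [hi])).1

theorem card_zeros_le (h : IsBaseLocus v) {l : Module.Dual ℝ (Fin 4 → ℝ)} (hl : l ≠ 0)
    (s : Finset (Fin 8)) (hs : ∀ j ∈ s, l (v j) = 0) : s.card ≤ 4 := by
  have h1 : Module.finrank ℝ (LinearMap.ker l) = 3 := by
    have h1 := Module.Dual.finrank_ker_add_one_of_ne_zero hl
    simp at h1
    omega
  refine le_trans ?_ (h.generic _ h1)
  rw [← Set.ncard_coe_finset]
  exact Set.ncard_le_ncard (fun j hj => hs j hj) (Set.toFinite _)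

theorem dual_eq_zero (h : IsBaseLocus v) {l : Module.Dual ℝ (Fin 4 → ℝ)}
    (hl : ∀ j, l (v j) = 0) : l = 0 := by
  by_contra h0
  simpa using h.card_zeros_le h0 Finset.univ fun j _ => hl j

/-- Otherwise every quadric through the points contains the line joining `v i` and `v j`, and the
base locus is infinite. -/
theorem exists_polar_ne_zero (h : IsBaseLocus v) {i j : Fin 8} (hij : i ≠ j) :
    ∃ f : Form 4 2, (∀ m, evalAt (v m) f = 0) ∧ polar f (v i) (v j) ≠ 0 := by
  by_contra! H
  have h1 : ∀ t : ℝ, ∃ m, ∃ c : ℝ, v i + t • v j = c • v m := by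
    refine fun t => h.base _ fun f hf => ?_
    rw [evalAt_add, evalAt_smul, map_smul, H f hf, hf, hf]
    simp
  choose m c hm using h1
  obtain ⟨s, t, hst, hm'⟩ := Finite.exists_ne_map_eq_of_infinite m
  have h2 : c t • (v i + s • v j) = c s • (v i + t • v j) := by
    rw [hm, hm, hm', smul_smul, smul_smul, mul_comm]
  have h3 : (c t - c s) • v i + (c t * s - c s * t) • v j = 0 := by
    rw [← sub_eq_zero] at h2
    rw [← h2]
    module
  obtain ⟨h4, h5⟩ := h.indep i j hij _ _ h3
  have h6 : c s * (s - t) = 0 := by linear_combination h5 - s * h4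
  have h7 : c s = 0 := (mul_eq_zero.1 h6).resolve_right (sub_ne_zero.2 hst)
  have h8 := hm s
  rw [h7, zero_smul] at h8
  simpa using (h.indep i j hij 1 s (by simpa using h8)).1

/-- No three of the points are collinear: a quadric vanishing at three points of a line contains the
line, against `exists_polar_ne_zero`. -/
theorem exists_dual_eq_one (h : IsBaseLocus v) {i j k : Fin 8} (hij : i ≠ j) (hik : i ≠ k)
    (hjk : j ≠ k) :
    ∃ l : Module.Dual ℝ (Fin 4 → ℝ), l (v i) = 0 ∧ l (v j) = 0 ∧ l (v k) = 1 := by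
  have h1 : v k ∉ Submodule.span ℝ {v i, v j} := by
    intro hk
    obtain ⟨a, b, hab⟩ := Submodule.mem_span_pair.1 hk
    obtain ⟨f, hf, hne⟩ := h.exists_polar_ne_zero hij
    have h2 := hf k
    rw [← hab, evalAt_add, evalAt_smul, evalAt_smul, hf, hf] at h2
    simp only [map_smul, LinearMap.smul_apply, smul_eq_mul, mul_zero, zero_add, add_zero,
      mul_eq_zero, hne, or_false, OfNat.ofNat_ne_zero, false_or] at h2
    rcases h2 with h2 | h2
    · simpa using (h.indep i k hik a (-1) (by rw [← hab]; simp [h2])).2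
    · simpa using (h.indep j k hjk b (-1) (by rw [← hab]; simp [h2])).2
  obtain ⟨l, hl, hp⟩ := Submodule.exists_dual_map_eq_bot_of_notMem h1 inferInstance
  have key : ∀ x ∈ Submodule.span ℝ {v i, v j}, l x = 0 := fun x hx => by
    rw [← Submodule.mem_bot ℝ, ← hp]
    exact Submodule.mem_map_of_mem hx
  refine ⟨(l (v k))⁻¹ • l, ?_, ?_, ?_⟩
  · simp [key (v i) (Submodule.subset_span (by simp))]
  · simp [key (v j) (Submodule.subset_span (by simp))]
  · simp [hl]

/-- Some plane passes through the first three points and misses the last one. -/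
def Separated (v : Fin 8 → Fin 4 → ℝ) (a b c i : Fin 8) : Prop :=
  ∃ l : Module.Dual ℝ (Fin 4 → ℝ), l (v a) = 0 ∧ l (v b) = 0 ∧ l (v c) = 0 ∧ l (v i) ≠ 0

/-- If both fail, the plane through `a`, `b`, `i` also contains `c` and `d`, hence five of the
points. -/
theorem separated_or (h : IsBaseLocus v) {i a b c d : Fin 8} (hn : [i, a, b, c, d].Nodup) :
    Separated v a b c i ∨ Separated v a b d i := by
  obtain ⟨l, hl, hla, hlb, hli⟩ := exists_dual_ne_zero_of_three (v a) (v b) (v i)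
  obtain ⟨m, hma, hmb, hmi⟩ := h.exists_dual_eq_one (i := a) (j := b) (k := i)
    (by rintro rfl; simp at hn) (by rintro rfl; simp at hn) (by rintro rfl; simp at hn)
  have key : ∀ c, ¬ Separated v a b c i → l (v c) = 0 := by
    intro c hc
    by_contra hlc
    refine hc ⟨m - (m (v c) / l (v c)) • l, ?_, ?_, ?_, ?_⟩ <;> simp [*]
  by_contra! H
  have h1 := h.card_zeros_le hl [i, a, b, c, d].toFinset (by
    simp only [List.mem_toFinset, List.mem_cons, List.not_mem_nil, or_false]
    rintro j (rfl | rfl | rfl | rfl | rfl)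
    exacts [hli, hla, hlb, key _ H.1, key _ H.2])
  rw [List.toFinset_card_of_nodup hn] at h1
  simp at h1

/-- The quadric is a pair of planes: the six remaining points are split into two triples whose
planes both miss `v i`. -/
theorem exists_six (h : IsBaseLocus v) {i j : Fin 8} (hij : i ≠ j) :
    ∃ f : Form 4 2, (∀ m, m ≠ i → m ≠ j → evalAt (v m) f = 0) ∧ evalAt (v i) f ≠ 0 := by
  have hcard : ((Finset.univ.erase i).erase j).card = 6 := by
    rw [Finset.card_erase_of_mem, Finset.card_erase_of_mem] <;> simp [hij.symm]
  let e := ((Finset.univ.erase i).erase j).orderEmbOfFin hcard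
  have he : ∀ t, e t ≠ i := fun t => by
    have := Finset.orderEmbOfFin_mem _ hcard t
    simp only [Finset.mem_erase] at this
    exact this.2.1
  have he' : ∀ t, i ≠ e t := fun t => (he t).symm
  have hr : ∀ m, m ≠ i → m ≠ j → ∃ t, e t = m := fun m hm hm' => by
    have := Finset.range_orderEmbOfFin _ hcard
    have h2 : m ∈ Set.range e := by rw [this]; simp [hm, hm']
    exact h2
  have hor : ∀ a b c d : Fin 6, [a, b, c, d].Nodup →
      Separated v (e a) (e b) (e c) i ∨ Separated v (e a) (e b) (e d) i := by
    intro a b c d hn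
    refine h.separated_or ?_
    have := hn.map e.injective
    simp only [List.map_cons, List.map_nil] at this
    exact List.nodup_cons.2 ⟨by simp [he'], this⟩
  have key : ∀ a b c d p q : Fin 6, (∀ t, t = a ∨ t = b ∨ t = c ∨ t = d ∨ t = p ∨ t = q) →
      Separated v (e a) (e b) (e c) i → Separated v (e d) (e p) (e q) i →
      ∃ f : Form 4 2, (∀ m, m ≠ i → m ≠ j → evalAt (v m) f = 0) ∧ evalAt (v i) f ≠ 0 := by
    rintro a b c d p q hall ⟨l, ha, hb, hc, hl⟩ ⟨m, hd, hp, hq, hm⟩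
    obtain ⟨f, hf⟩ := exists_planePair l m
    refine ⟨f, fun n hn hn' => ?_, by rw [hf]; exact mul_ne_zero hl hm⟩
    obtain ⟨t, rfl⟩ := hr n hn hn'
    rw [hf]
    rcases hall t with rfl | rfl | rfl | rfl | rfl | rfl <;> simp [*]
  -- If one half of the split 012 | 345 is bad, exchanging one of its points for any point of the
  -- other half makes it good. `hor` then picks an exchange that leaves the other triple good too.
  by_cases h1 : Separated v (e 0) (e 1) (e 2) i
  · by_cases h2 : Separated v (e 3) (e 4) (e 5) i
    · exact key _ _ _ _ _ _ (by decide) h1 h2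
    · have h3 : ∀ t : Fin 6, [3, 4, 5, t].Nodup → Separated v (e 3) (e 4) (e t) i :=
        fun t ht => (hor 3 4 5 t ht).resolve_left h2
      rcases hor 2 5 0 1 (by decide) with h4 | h4
      · exact key _ _ _ _ _ _ (by decide) (h3 1 (by decide)) h4
      · exact key _ _ _ _ _ _ (by decide) (h3 0 (by decide)) h4
  · have h3 : ∀ t : Fin 6, [0, 1, 2, t].Nodup → Separated v (e 0) (e 1) (e t) i :=
      fun t ht => (hor 0 1 2 t ht).resolve_left h1
    rcases hor 2 5 3 4 (by decide) with h4 | h4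
    · exact key _ _ _ _ _ _ (by decide) (h3 4 (by decide)) h4
    · exact key _ _ _ _ _ _ (by decide) (h3 3 (by decide)) h4

theorem relation_ne_zero (h : IsBaseLocus v) {u : Fin 8 → ℝ} (hu : IsCayleyBacharach v u)
    (j : Fin 8) : u j ≠ 0 := by
  intro hj
  obtain ⟨i, hi⟩ := Function.ne_iff.1 hu.1
  have hij : i ≠ j := by rintro rfl; exact hi hj
  obtain ⟨f, hf, hfi⟩ := h.exists_six hij
  have h1 := hu.2 f
  rw [Finset.sum_eq_single i] at h1
  · exact (mul_ne_zero hi hfi) h1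
  · intro m _ hm
    by_cases hmj : m = j
    · simp [hmj, hj]
    · simp [hf m hm hmj]
  · simp

theorem relation_unique (h : IsBaseLocus v) {u w : Fin 8 → ℝ} (hu : IsCayleyBacharach v u)
    (hw : ∀ f : Form 4 2, ∑ j, w j * evalAt (v j) f = 0) : ∃ c : ℝ, w = c • u := by
  -- This multiple cancels coordinate 0, whereas a nontrivial relation has no zero coordinate.
  refine ⟨w 0 / u 0, ?_⟩
  by_contra hne
  have hcb : IsCayleyBacharach v (w - (w 0 / u 0) • u) := by
    refine ⟨sub_ne_zero.2 hne, fun f => ?_⟩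
    have : ∑ j, (w - (w 0 / u 0) • u) j * evalAt (v j) f
        = ∑ j, w j * evalAt (v j) f - (w 0 / u 0) * ∑ j, u j * evalAt (v j) f := by
      rw [Finset.mul_sum, ← Finset.sum_sub_distrib]
      exact Finset.sum_congr rfl fun j _ => by simp; ring
    rw [this, hw, hu.2]
    simp
  exact h.relation_ne_zero hcb 0 (by simp [h.relation_ne_zero hu 0])

end IsBaseLocus

/-! ### Existence of the Cayley–Bacharach relation. -/

theorem hasStrictFDerivAt_evalAt {n : ℕ} (f : Form n 2) (x : Fin n → ℝ) :
    HasStrictFDerivAt (fun y => evalAt y f)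
      ((2 : ℝ) • LinearMap.toContinuousLinearMap (polar f x)) x := by
  let B := LinearMap.toContinuousBilinearMap (polar f)
  have hB : ∀ y z, B y z = polar f y z := fun y z => by simp [B]
  have h := (B.hasStrictFDerivAt (x := x)).clm_apply (hasStrictFDerivAt_id x)
  have h1 : (fun y => (B y) (id y)) = fun y => evalAt y f := by
    funext y
    rw [hB, id, polar_self]
  rw [h1] at h
  convert! h using 1
  ext y
  simp [hB, polar_comm f y x, two_mul]

theorem exists_basis_ker {V W : Type*} [AddCommGroup V] [Module ℝ V] [FiniteDimensional ℝ V]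
    [AddCommGroup W] [Module ℝ W] (L : V →ₗ[ℝ] W) {n : ℕ}
    (h : Module.finrank ℝ (LinearMap.ker L) = n) :
    ∃ b : Fin n → V, (∀ t, L (b t) = 0) ∧ (∀ k, L k = 0 → ∃ c : Fin n → ℝ, k = ∑ t, c t • b t) ∧
      ∀ c : Fin n → ℝ, ∑ t, c t • b t = 0 → c = 0 := by
  let b := Module.finBasisOfFinrankEq ℝ _ h
  refine ⟨fun t => b t, fun t => (b t).2, fun k hk => ?_, fun c hc => ?_⟩
  · have h1 := congrArg Subtype.val (b.sum_repr ⟨k, hk⟩)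
    refine ⟨b.repr ⟨k, hk⟩, ?_⟩
    refine h1.symm.trans ?_
    rw [Submodule.coe_sum]
    rfl
  · exact funext (Fintype.linearIndependent_iff.1 b.linearIndependent c
      (Subtype.ext (by simpa using hc)))

namespace IsBaseLocus

variable {v : Fin 8 → Fin 4 → ℝ}

theorem exists_nhds_forall_smul (h : IsBaseLocus v) (i : Fin 8) :
    ∃ U ∈ nhds (v i), ∀ x ∈ U, ∀ m, ∀ c : ℝ, x = c • v m → m = i := by
  let S : Set (Fin 4 → ℝ) := ⋃ m ∈ {m | m ≠ i}, (Submodule.span ℝ {v m} : Set (Fin 4 → ℝ))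
  have hS : IsClosed S := Set.Finite.isClosed_biUnion (Set.toFinite _) fun m _ =>
    Submodule.closed_of_finiteDimensional _
  refine ⟨Sᶜ, hS.isOpen_compl.mem_nhds ?_, ?_⟩
  · simp only [S, Set.mem_compl_iff, Set.mem_iUnion, not_exists]
    intro m hm hmem
    obtain ⟨c, hc⟩ := Submodule.mem_span_singleton.1 hmem
    simpa using (h.indep i m (Ne.symm hm) 1 (-c) (by rw [← hc]; simp)).1
  · intro x hx m c hxc
    by_contra hm
    refine hx (Set.mem_biUnion hm ?_)
    rw [hxc]
    exact Submodule.smul_mem _ _ (Submodule.mem_span_singleton_self _)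

/-- If all members were smooth at `v i`, then `f` and `g` would meet transversally there, and their
common zeros would contain a curve through this point. -/
theorem exists_singular_of_pencil (h : IsBaseLocus v) {f g : Form 4 2}
    (hf : ∀ j, evalAt (v j) f = 0) (hg : ∀ j, evalAt (v j) g = 0)
    (hK : ∀ k : Form 4 2, (∀ j, evalAt (v j) k = 0) → ∃ a b : ℝ, k = a • f + b • g)
    (i : Fin 8) : ∃ s t : ℝ, (s ≠ 0 ∨ t ≠ 0) ∧ polar (s • f + t • g) (v i) = 0 := by
  by_contra! H
  have H' : ∀ s t : ℝ, (∀ x, s * polar f (v i) x + t * polar g (v i) x = 0) → s = 0 ∧ t = 0 := by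
    intro s t hst
    by_contra hne
    refine H s t (by tauto) (LinearMap.ext fun x => ?_)
    simpa using hst x
  obtain ⟨w, hw, hwv⟩ : ∃ w ∈ LinearMap.ker ((polar f (v i)).prod (polar g (v i))),
      w ∉ Submodule.span ℝ {v i} := by
    by_contra! hle
    have h1 := Submodule.finrank_mono (R := ℝ) (show _ ≤ _ from hle)
    have h2 := finrank_span_singleton (K := ℝ) (h.ne_zero i)
    have h3 := LinearMap.finrank_range_add_finrank_ker ((polar f (v i)).prod (polar g (v i)))
    have h4 := Submodule.finrank_le (LinearMap.range ((polar f (v i)).prod (polar g (v i))))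
    simp at h3 h4
    omega
  -- `w` is a common tangent direction, and `c` a coordinate along it that vanishes at `v i`; `(f,
  -- g, c)` is then a submersion at `v i`.
  obtain ⟨c, hcw, hc⟩ := Submodule.exists_dual_map_eq_bot_of_notMem hwv inferInstance
  have hcv : c (v i) = 0 := by
    rw [← Submodule.mem_bot ℝ, ← hc]
    exact Submodule.mem_map_of_mem (Submodule.mem_span_singleton_self _)
  obtain ⟨hwf, hwg⟩ : polar f (v i) w = 0 ∧ polar g (v i) w = 0 := by simpa using hw
  let L : (Fin 4 → ℝ) →L[ℝ] Fin 3 → ℝ := ContinuousLinearMap.pi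
    ![(2 : ℝ) • LinearMap.toContinuousLinearMap (polar f (v i)),
      (2 : ℝ) • LinearMap.toContinuousLinearMap (polar g (v i)),
      LinearMap.toContinuousLinearMap c]
  let F : (Fin 4 → ℝ) → Fin 3 → ℝ := fun x => ![evalAt x f, evalAt x g, c x]
  have hF : HasStrictFDerivAt F L (v i) := by
    rw [hasStrictFDerivAt_pi']
    intro t
    fin_cases t
    · exact hasStrictFDerivAt_evalAt f (v i)
    · exact hasStrictFDerivAt_evalAt g (v i)
    · exact (LinearMap.toContinuousLinearMap c).hasStrictFDerivAt
  have hL : LinearMap.range (L : (Fin 4 → ℝ) →ₗ[ℝ] Fin 3 → ℝ) = ⊤ := by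
    refine surjective_of_forall_relation _ fun a ha => ?_
    simp only [Fin.sum_univ_three] at ha
    have hL' : ∀ x, a 0 * (2 * polar f (v i) x) + a 1 * (2 * polar g (v i) x) + a 2 * c x = 0 :=
      fun x => by simpa [L] using ha x
    have h2 : a 2 = 0 := by simpa [hwf, hwg, hcw] using hL' w
    obtain ⟨h0, h1⟩ := H' (a 0) (a 1) fun x => by
      have := hL' x
      rw [h2] at this
      linarith
    ext t
    fin_cases t <;> assumption
  have hmap := hF.map_nhds_eq_of_surj hL
  have hFv : F (v i) = ![0, 0, 0] := by simp [F, hf, hg, hcv]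
  obtain ⟨U, hU, hUi⟩ := h.exists_nhds_forall_smul i
  have h1 : F '' U ∈ nhds (![0, 0, 0] : Fin 3 → ℝ) := by
    rw [← hFv, ← hmap]
    exact Filter.image_mem_map hU
  have h2 : Filter.Tendsto (fun ε : ℝ => (![0, 0, ε] : Fin 3 → ℝ)) (nhds 0) (nhds ![0, 0, 0]) := by
    have : Continuous fun ε : ℝ => (![0, 0, ε] : Fin 3 → ℝ) := by fun_prop
    exact this.tendsto 0
  -- A common zero near `v i` with `c x = ε ≠ 0`: it must be a multiple of `v i`, where `c`
  -- vanishes.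
  obtain ⟨ε, ⟨x, hxU, hx⟩, hε⟩ := (((h2.eventually h1).filter_mono nhdsWithin_le_nhds).and
    (self_mem_nhdsWithin : ({0}ᶜ : Set ℝ) ∈ nhdsWithin 0 {0}ᶜ)).exists
  have hx0 : evalAt x f = 0 := congrFun hx 0
  have hx1 : evalAt x g = 0 := congrFun hx 1
  have hx2 : c x = ε := congrFun hx 2
  obtain ⟨m, r, hr⟩ := h.base x fun k hk => by
    obtain ⟨a, b, rfl⟩ := hK k hk
    simp [hx0, hx1]
  obtain rfl := hUi x hxU m r hr
  apply hε
  rw [← hx2, hr]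
  simp [hcv]

/-- Evaluation of the forms of degree `d` at the eight points. -/
noncomputable def evalMap (v : Fin 8 → Fin 4 → ℝ) (d : ℕ) : Form 4 d →ₗ[ℝ] Fin 8 → ℝ :=
  LinearMap.pi fun j => evalAt (v j)

@[simp]
theorem evalMap_apply (v : Fin 8 → Fin 4 → ℝ) (d : ℕ) (f : Form 4 d) (j : Fin 8) :
    evalMap v d f j = evalAt (v j) f := rfl

theorem mem_ker_evalMap {d : ℕ} {f : Form 4 d} :
    f ∈ LinearMap.ker (evalMap v d) ↔ ∀ j, evalAt (v j) f = 0 := by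
  rw [LinearMap.mem_ker, funext_iff]
  rfl

theorem eq_zero_of_polar_eq_zero (h : IsBaseLocus v) {f : Form 4 2} (hf : ∀ j, polar f (v j) = 0) :
    f = 0 := by
  refine form_ext fun x => ?_
  rw [← polar_self]
  have : polar f x = 0 := h.dual_eq_zero fun j => by
    rw [polar_comm, hf]
    rfl
  simp [this]

/-- Without a relation only a pencil passes through the points, with a singular member at each of
them. These members coincide up to scaling, and a quadric singular at eight spanning points is zero.
-/
theorem exists_relation (h : IsBaseLocus v) : ∃ u, IsCayleyBacharach v u := by
  by_contra! H
  have hs : LinearMap.range (evalMap v 2) = ⊤ := by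
    refine surjective_of_forall_relation _ fun w hw => ?_
    by_contra hne
    exact H w ⟨hne, hw⟩
  have hfin : Module.finrank ℝ (LinearMap.ker (evalMap v 2)) = 2 := by
    have h1 := LinearMap.finrank_range_add_finrank_ker (evalMap v 2)
    rw [hs, finrank_form] at h1
    simp [Nat.multichoose_eq, Nat.choose] at h1
    omega
  obtain ⟨b, hb, hK, hli⟩ := exists_basis_ker _ hfin
  simp only [funext_iff, evalMap_apply, Pi.zero_apply, Fin.sum_univ_two] at hb hK hli
  choose s t hst hsing using h.exists_singular_of_pencil (hb 0) (hb 1) fun k hk => by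
    obtain ⟨c, hc⟩ := hK k hk
    exact ⟨_, _, hc⟩
  -- Two independent members singular at `v 0` and at `v i` would make every polar form of the
  -- pencil vanish at `(v 0, v i)`.
  have hdet : ∀ i, s 0 * t i = t 0 * s i := by
    intro i
    by_contra hne
    have hi : 0 ≠ i := by
      rintro rfl
      exact hne (mul_comm _ _)
    obtain ⟨f, hf, hfi⟩ := h.exists_polar_ne_zero hi
    have e1 : s 0 * polar (b 0) (v 0) (v i)
        + t 0 * polar (b 1) (v 0) (v i) = 0 := by
      simpa using LinearMap.congr_fun (hsing 0) (v i)
    have e2 : s i * polar (b 0) (v 0) (v i)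
        + t i * polar (b 1) (v 0) (v i) = 0 := by
      rw [polar_comm, polar_comm (b 1)]
      simpa using LinearMap.congr_fun (hsing i) (v 0)
    have hd : s 0 * t i - t 0 * s i ≠ 0 := sub_ne_zero.2 hne
    have e3 : polar (b 0) (v 0) (v i) = 0 :=
      (mul_eq_zero.1 (by linear_combination t i * e1 - t 0 * e2 :
        (s 0 * t i - t 0 * s i) * _ = 0)).resolve_left hd
    have e4 : polar (b 1) (v 0) (v i) = 0 :=
      (mul_eq_zero.1 (by linear_combination s 0 * e2 - s i * e1 :
        (s 0 * t i - t 0 * s i) * _ = 0)).resolve_left hd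
    obtain ⟨x, rfl⟩ := hK f hf
    simp [e3, e4] at hfi
  have hker : ∀ i, polar (s 0 • b 0 + t 0 • b 1) (v i) = 0 := by
    intro i
    have hi := hsing i
    have h1 : s i • polar (s 0 • b 0 + t 0 • b 1) (v i) = 0 := by
      have e : s i • polar (s 0 • b 0 + t 0 • b 1) (v i)
          = s 0 • polar (s i • b 0 + t i • b 1) (v i) := by
        have := hdet i
        simp only [map_add, map_smul, LinearMap.add_apply, LinearMap.smul_apply]
        match_scalars <;> linarith
      rw [e, hi, smul_zero]
    have h2 : t i • polar (s 0 • b 0 + t 0 • b 1) (v i) = 0 := by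
      have e : t i • polar (s 0 • b 0 + t 0 • b 1) (v i)
          = t 0 • polar (s i • b 0 + t i • b 1) (v i) := by
        have := hdet i
        simp only [map_add, map_smul, LinearMap.add_apply, LinearMap.smul_apply]
        match_scalars <;> linarith
      rw [e, hi, smul_zero]
    rcases hst i with h0 | h0
    · exact (smul_eq_zero.1 h1).resolve_left h0
    · exact (smul_eq_zero.1 h2).resolve_left h0
  have h1 := hli ![s 0, t 0] (h.eq_zero_of_polar_eq_zero hker) 0
  have h2 := hli ![s 0, t 0] (h.eq_zero_of_polar_eq_zero hker) 1
  rcases hst 0 with h0 | h0 <;> contradiction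

end IsBaseLocus

/-! ### No quadric through the eight points is singular at one of them. -/

theorem evalAt_comb_four {n : ℕ} (g : Form n 2) {a b c d : Fin n → ℝ} (ha : evalAt a g = 0)
    (hb : evalAt b g = 0) (hc : evalAt c g = 0) (hd : evalAt d g = 0) (t x y z : ℝ) :
    evalAt (t • a + x • b + y • c + z • d) g =
      2 * (t * (x * polar g a b + y * polar g a c + z * polar g a d) +
        (x * y * polar g b c + y * z * polar g c d + x * z * polar g b d)) := by
  simp only [evalAt_add, evalAt_smul, map_add, map_smul, LinearMap.add_apply,
    LinearMap.smul_apply, smul_eq_mul, ha, hb, hc, hd]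
  ring

namespace IsBaseLocus

variable {v : Fin 8 → Fin 4 → ℝ}

theorem ne_comb_two (h : IsBaseLocus v) {a b c : Fin 8} (hab : a ≠ b) (hac : a ≠ c)
    (hbc : b ≠ c) (s t : ℝ) : v c ≠ s • v a + t • v b := by
  intro hc
  obtain ⟨l, hla, hlb, hlc⟩ := h.exists_dual_eq_one hab hac hbc
  rw [hc] at hlc
  simp [hla, hlb] at hlc

/-- Two planes sharing one of the points cover at most 4 + 4 - 1 = 7 of them. -/
theorem eq_zero_or_eq_zero_of_mul (h : IsBaseLocus v) {l m : Module.Dual ℝ (Fin 4 → ℝ)}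
    {i : Fin 8} (hl : l (v i) = 0) (hm : m (v i) = 0) (hlm : ∀ j, l (v j) * m (v j) = 0) :
    l = 0 ∨ m = 0 := by
  classical
  by_contra! H
  let A : Finset (Fin 8) := Finset.univ.filter fun j => l (v j) = 0
  let B : Finset (Fin 8) := Finset.univ.filter fun j => m (v j) = 0
  have h1 := h.card_zeros_le H.1 A (by simp [A])
  have h2 := h.card_zeros_le H.2 B (by simp [B])
  have h3 := Finset.card_union_add_card_inter A B
  have h4 : A ∪ B = Finset.univ := by
    ext j
    simpa [A, B] using hlm j
  have h5 : 0 < (A ∩ B).card := Finset.card_pos.2 ⟨i, by simp [A, B, hl, hm]⟩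
  rw [h4] at h3
  simp only [Finset.card_univ, Fintype.card_fin] at h3
  omega

/-- Every one of the eight vectors is part of a basis made of four of them. -/
theorem exists_coordinates (h : IsBaseLocus v) (i : Fin 8) : ∃ j k m : Fin 8,
    [i, j, k, m].Nodup ∧ ∃ T X Y Z : Module.Dual ℝ (Fin 4 → ℝ),
      (∀ x, x = T x • v i + X x • v j + Y x • v k + Z x • v m) ∧
      (X (v i) = 0 ∧ X (v j) = 1 ∧ X (v k) = 0 ∧ X (v m) = 0) ∧
      (Y (v i) = 0 ∧ Y (v j) = 0 ∧ Y (v k) = 1 ∧ Y (v m) = 0) ∧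
      (Z (v i) = 0 ∧ Z (v j) = 0 ∧ Z (v k) = 0 ∧ Z (v m) = 1) := by
  obtain ⟨j, k, hij, hik, hjk⟩ : ∃ j k : Fin 8, i ≠ j ∧ i ≠ k ∧ j ≠ k := by
    revert i
    decide
  obtain ⟨l, hl, hli, hlj, hlk⟩ := exists_dual_ne_zero_of_three (v i) (v j) (v k)
  obtain ⟨m, hm⟩ : ∃ m, l (v m) ≠ 0 := by
    by_contra! H
    exact hl (h.dual_eq_zero H)
  have him : i ≠ m := by rintro rfl; exact hm hli
  have hjm : j ≠ m := by rintro rfl; exact hm hlj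
  have hkm : k ≠ m := by rintro rfl; exact hm hlk
  refine ⟨j, k, m, by simp [*], ?_⟩
  have hlin : LinearIndependent ℝ ![v i, v j, v k, v m] := by
    rw [Fintype.linearIndependent_iff]
    intro g hg
    simp only [Fin.sum_univ_four, Matrix.cons_val] at hg
    have h3 : g 3 = 0 := by simpa [hli, hlj, hlk, hm] using congrArg l hg
    rw [h3, zero_smul, add_zero] at hg
    obtain ⟨l', hi', hj', hk'⟩ := h.exists_dual_eq_one hij hik hjk
    have h2 : g 2 = 0 := by simpa [hi', hj', hk'] using congrArg l' hg
    rw [h2, zero_smul, add_zero] at hg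
    obtain ⟨h0, h1⟩ := h.indep i j hij _ _ hg
    intro t
    fin_cases t <;> assumption
  let b := basisOfLinearIndependentOfCardEqFinrank hlin (by simp)
  have hb : ⇑b = ![v i, v j, v k, v m] := coe_basisOfLinearIndependentOfCardEqFinrank hlin (by simp)
  have b0 : b 0 = v i := by rw [hb]; rfl
  have b1 : b 1 = v j := by rw [hb]; rfl
  have b2 : b 2 = v k := by rw [hb]; rfl
  have b3 : b 3 = v m := by rw [hb]; rfl
  refine ⟨b.coord 0, b.coord 1, b.coord 2, b.coord 3, fun x => ?_, ?_⟩
  · have := b.sum_repr x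
    rw [Fin.sum_univ_four, b0, b1, b2, b3] at this
    exact this.symm
  · simp [← b0, ← b1, ← b2, ← b3]

/-- A nonzero such `f` is a cone with vertex `v i` over a conic. On a ruling, every quadric through
the vertex has at most one further zero unless it contains the ruling. For two quadrics of the
system these residual zeros agree on four rulings, hence by a degree bound on all, and the base
locus is infinite. -/
theorem eq_zero_of_singular (h : IsBaseLocus v) {f : Form 4 2} (hf : ∀ j, evalAt (v j) f = 0)
    {i : Fin 8} (hs : polar f (v i) = 0) : f = 0 := by
  by_contra hne
  obtain ⟨j, k, m, hnd, T, X, Y, Z, hx, ⟨Xi, Xj, Xk, Xm⟩, ⟨Yi, Yj, Yk, Ym⟩, ⟨Zi, Zj, Zk, Zm⟩⟩ :=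
    h.exists_coordinates i
  simp only [List.nodup_cons, List.mem_cons, List.not_mem_nil, or_false, not_or, not_false_eq_true,
    List.nodup_nil, and_true] at hnd
  obtain ⟨⟨hij, hik, him⟩, ⟨hjk, hjm⟩, hkm⟩ := hnd
  set α := polar f (v j) (v k) with hα
  set β := polar f (v k) (v m) with hβ
  set γ := polar f (v j) (v m) with hγ
  have hfx : ∀ x, evalAt x f = 2 * (α * (X x * Y x) + β * (Y x * Z x) + γ * (X x * Z x)) := by
    intro x
    conv_lhs => rw [hx x]
    rw [evalAt_comb_four f (hf i) (hf j) (hf k) (hf m), hs]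
    simp only [LinearMap.zero_apply]
    ring
  have hfv : ∀ n, α * (X (v n) * Y (v n)) + β * (Y (v n) * Z (v n)) + γ * (X (v n) * Z (v n)) = 0 :=
    fun n => by linarith [hfx (v n), hf n]
  have hzero : α = 0 → β = 0 → γ = 0 → False := fun h1 h2 h3 =>
    hne (form_ext fun x => by rw [hfx, h1, h2, h3]; simp)
  -- If a coefficient vanishes, the cone splits into two planes through `v i`.
  have hα0 : α ≠ 0 := by
    intro h0
    rcases h.eq_zero_or_eq_zero_of_mul (l := Z) (m := β • Y + γ • X) Zi (by simp [Xi, Yi])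
      (fun n => by
        have := hfv n
        rw [h0] at this
        simp only [LinearMap.add_apply, LinearMap.smul_apply, smul_eq_mul]
        linarith) with h1 | h1
    · simp [h1] at Zm
    · exact hzero h0 (by simpa [Yk, Xk] using LinearMap.congr_fun h1 (v k))
        (by simpa [Yj, Xj] using LinearMap.congr_fun h1 (v j))
  have hβ0 : β ≠ 0 := by
    intro h0
    rcases h.eq_zero_or_eq_zero_of_mul (l := X) (m := α • Y + γ • Z) Xi (by simp [Zi, Yi])
      (fun n => by
        have := hfv n
        rw [h0] at this
        simp only [LinearMap.add_apply, LinearMap.smul_apply, smul_eq_mul]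
        linarith) with h1 | h1
    · simp [h1] at Xj
    · exact hzero (by simpa [Yk, Zk] using LinearMap.congr_fun h1 (v k)) h0
        (by simpa [Ym, Zm] using LinearMap.congr_fun h1 (v m))
  have hγ0 : γ ≠ 0 := by
    intro h0
    rcases h.eq_zero_or_eq_zero_of_mul (l := Y) (m := α • X + β • Z) Yi (by simp [Zi, Xi])
      (fun n => by
        have := hfv n
        rw [h0] at this
        simp only [LinearMap.add_apply, LinearMap.smul_apply, smul_eq_mul]
        linarith) with h1 | h1
    · simp [h1] at Yk
    · exact hzero (by simpa [Xj, Zj] using LinearMap.congr_fun h1 (v j))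
        (by simpa [Xm, Zm] using LinearMap.congr_fun h1 (v m)) h0
  let S : Finset (Fin 8) := Finset.univ \ {i, j, k, m}
  have hS : ∀ n ∈ S, i ≠ n ∧ j ≠ n ∧ k ≠ n ∧ m ≠ n := by
    intro n hn
    simpa [S, not_or, eq_comm] using hn
  have hScard : 4 ≤ S.card := by
    rw [Finset.card_sdiff_of_subset (Finset.subset_univ _)]
    have := Finset.card_le_four (a := i) (b := j) (c := k) (d := m)
    simp only [Finset.card_univ, Fintype.card_fin]
    omega
  have hXYZ : ∀ n ∈ S, X (v n) ≠ 0 ∧ Y (v n) ≠ 0 ∧ Z (v n) ≠ 0 := by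
    intro n hn
    obtain ⟨hi, hj, hk, hm⟩ := hS n hn
    have hxn := hx (v n)
    have hXY : X (v n) = 0 → Y (v n) ≠ 0 := by
      intro h1 h2
      rw [h1, h2] at hxn
      exact h.ne_comb_two him hi hm _ _ (by simpa using hxn)
    have hXZ : X (v n) = 0 → Z (v n) ≠ 0 := by
      intro h1 h2
      rw [h1, h2] at hxn
      exact h.ne_comb_two hik hi hk _ _ (by simpa using hxn)
    have hYZ : Y (v n) = 0 → Z (v n) ≠ 0 := by
      intro h1 h2
      rw [h1, h2] at hxn
      exact h.ne_comb_two hij hi hj _ _ (by simpa using hxn)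
    have hfn := hfv n
    refine ⟨fun h0 => ?_, fun h0 => ?_, fun h0 => ?_⟩
    · simp [h0, hβ0, hXY h0, hXZ h0] at hfn
    · have hX : X (v n) ≠ 0 := fun h1 => hXY h1 h0
      simp [h0, hγ0, hX, hYZ h0] at hfn
    · have hX : X (v n) ≠ 0 := fun h1 => hXZ h1 h0
      have hY : Y (v n) ≠ 0 := fun h1 => hYZ h1 h0
      simp [h0, hα0, hX, hY] at hfn
  -- The ruling through `v n`. Equal values would put two of the points on a line with `v i`.
  let r : Fin 8 → ℝ := fun n => Y (v n) / X (v n)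
  have hr : Set.InjOn r S := by
    intro n hn n' hn' hrr
    by_contra hnn
    obtain ⟨x0, y0, z0⟩ := hXYZ n hn
    obtain ⟨x1, y1, z1⟩ := hXYZ n' hn'
    have hi := (hS n hn).1
    have hi' := (hS n' hn').1
    set c := X (v n') / X (v n)
    have e1 : X (v n') = c * X (v n) := by simp only [c]; field_simp
    have e2 : Y (v n') = c * Y (v n) := by
      simp only [r] at hrr
      field_simp at hrr
      simp only [c]
      field_simp
      linarith
    have e3 : Z (v n') = c * Z (v n) := by
      have h1 := hfv n
      have h2 := hfv n'
      rw [e1, e2] at h2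
      have hc : c ≠ 0 := div_ne_zero x1 x0
      have h3 : β * Y (v n) + γ * X (v n) ≠ 0 := by
        intro h0
        have : α * (X (v n) * Y (v n)) = 0 := by linear_combination h1 - Z (v n) * h0
        simp [hα0, x0, y0] at this
      have h4 : c * (β * Y (v n) + γ * X (v n)) * (Z (v n') - c * Z (v n)) = 0 := by
        linear_combination h2 - c ^ 2 * h1
      exact sub_eq_zero.1 ((mul_eq_zero.1 h4).resolve_left (mul_ne_zero hc h3))
    refine h.ne_comb_two hi hi' hnn (T (v n') - c * T (v n)) c ?_
    calc v n' = T (v n') • v i + X (v n') • v j + Y (v n') • v k + Z (v n') • v m := hx _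
      _ = (T (v n') - c * T (v n)) • v i +
          c • (T (v n) • v i + X (v n) • v j + Y (v n) • v k + Z (v n) • v m) := by
        rw [e1, e2, e3]
        module
      _ = (T (v n') - c * T (v n)) • v i + c • v n := by rw [← hx (v n)]
  -- The conic `αXY + βYZ + γXZ = 0` is parametrized by `s = Y / X` as `(w, s w, -α s)`. On the
  -- ruling over `s`, a quadric `g` becomes `t P + μ s w Q` up to the factor `2 μ`.
  let w : Polynomial ℝ := .C β * .X + .C γ
  let P : Form 4 2 → Polynomial ℝ := fun g => .C (polar g (v i) (v j)) * w +
    .C (polar g (v i) (v k)) * .X * w - .C (α * polar g (v i) (v m)) * .X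
  let Q : Form 4 2 → Polynomial ℝ := fun g => .C (polar g (v j) (v k)) * w -
    .C (α * polar g (v k) (v m)) * .X - .C (α * polar g (v j) (v m))
  have hPQ : ∀ g : Form 4 2, (∀ n, evalAt (v n) g = 0) → ∀ t μ s : ℝ,
      evalAt (t • v i + (μ * w.eval s) • v j + (μ * (s * w.eval s)) • v k + (μ * (-α * s)) • v m) g
        = 2 * μ * (t * (P g).eval s + μ * s * w.eval s * (Q g).eval s) := by
    intro g hg t μ s
    rw [evalAt_comb_four g (hg i) (hg j) (hg k) (hg m)]
    simp only [P, Q, Polynomial.eval_add, Polynomial.eval_sub, Polynomial.eval_mul,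
      Polynomial.eval_C, Polynomial.eval_X]
    ring
  have hroot : ∀ g g' : Form 4 2, (∀ n, evalAt (v n) g = 0) → (∀ n, evalAt (v n) g' = 0) →
      ∀ n ∈ S, (P g * Q g' - P g' * Q g).eval (r n) = 0 := by
    intro g g' hg hg' n hn
    obtain ⟨x0, y0, z0⟩ := hXYZ n hn
    have hw : w.eval (r n) = (β * Y (v n) + γ * X (v n)) / X (v n) := by
      simp only [w, r, Polynomial.eval_add, Polynomial.eval_mul, Polynomial.eval_C,
        Polynomial.eval_X]
      field_simp
    have hw' : Z (v n) * (β * Y (v n) + γ * X (v n)) = -α * (X (v n) * Y (v n)) := by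
      linear_combination hfv n
    have hw1 : β * Y (v n) + γ * X (v n) ≠ 0 := by
      intro h0
      rw [h0] at hw'
      simp [hα0, x0, y0] at hw'
    have hw0 : w.eval (r n) ≠ 0 := by
      rw [hw]
      exact div_ne_zero hw1 x0
    set μ := X (v n) / w.eval (r n) with hμ
    have hμ0 : μ ≠ 0 := div_ne_zero x0 hw0
    have hr0 : r n ≠ 0 := div_ne_zero y0 x0
    have e1 : X (v n) = μ * w.eval (r n) := by rw [hμ]; field_simp
    have e2 : Y (v n) = μ * (r n * w.eval (r n)) := by
      have : μ * (r n * w.eval (r n)) = r n * X (v n) := by rw [e1]; ring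
      rw [this]
      simp only [r]
      field_simp
    have e3 : Z (v n) = μ * (-α * r n) := by
      have h1 : w.eval (r n) * X (v n) = β * Y (v n) + γ * X (v n) := by
        rw [hw]
        field_simp
      have h2 : r n * X (v n) = Y (v n) := by
        simp only [r]
        field_simp
      apply mul_right_cancel₀ hw1
      linear_combination hw' - α * μ * r n * h1 - α * r n * X (v n) * e1 + α * X (v n) * h2
    have hvn : v n = T (v n) • v i + (μ * w.eval (r n)) • v j +
        (μ * (r n * w.eval (r n))) • v k + (μ * (-α * r n)) • v m := by
      rw [← e1, ← e2, ← e3]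
      exact hx (v n)
    have h1 := hPQ g hg (T (v n)) μ (r n)
    have h2 := hPQ g' hg' (T (v n)) μ (r n)
    rw [← hvn, hg] at h1
    rw [← hvn, hg'] at h2
    have h3 : (T (v n) * (P g).eval (r n) + μ * r n * w.eval (r n) * (Q g).eval (r n)) = 0 := by
      have : 2 * μ ≠ 0 := by simpa using hμ0
      exact (mul_eq_zero.1 h1.symm).resolve_left this
    have h4 : (T (v n) * (P g').eval (r n) + μ * r n * w.eval (r n) * (Q g').eval (r n)) = 0 := by
      have : 2 * μ ≠ 0 := by simpa using hμ0
      exact (mul_eq_zero.1 h2.symm).resolve_left this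
    rw [Polynomial.eval_sub, Polynomial.eval_mul, Polynomial.eval_mul]
    refine (mul_eq_zero.1 (?_ : μ * r n * w.eval (r n) * _ = 0)).resolve_left
      (mul_ne_zero (mul_ne_zero hμ0 hr0) hw0)
    linear_combination (P g).eval (r n) * h4 - (P g').eval (r n) * h3
  have hD : ∀ g g' : Form 4 2, (∀ n, evalAt (v n) g = 0) → (∀ n, evalAt (v n) g' = 0) →
      P g * Q g' - P g' * Q g = 0 := by
    intro g g' hg hg'
    refine Polynomial.eq_zero_of_natDegree_lt_card_of_eval_eq_zero' _ (S.image r) ?_ ?_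
    · intro s hs
      obtain ⟨n, hn, rfl⟩ := Finset.mem_image.1 hs
      exact hroot g g' hg hg' n hn
    · rw [Finset.card_image_of_injOn hr]
      -- `P` has degree at most 2 and `Q` at most 1, while there are at least four roots.
      have : (P g * Q g' - P g' * Q g).natDegree ≤ 3 := by
        simp only [P, Q, w]
        compute_degree
      omega
  obtain ⟨g, hg, hgij⟩ := h.exists_polar_ne_zero hij
  have hP0 : P g ≠ 0 := by
    intro h0
    have : (P g).eval 0 = 0 := by rw [h0]; simp
    simp [P, w, hgij, hγ0] at this
  have hw0 : w ≠ 0 := by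
    intro h0
    have : w.eval 0 = 0 := by rw [h0]; simp
    simp [w, hγ0] at this
  have hinf : Infinite ↥{s | (P g * w).IsRoot s}ᶜ :=
    (Polynomial.finite_setOfPred_isRoot (mul_ne_zero hP0 hw0)).infinite_compl.to_subtype
  have hpt : ∀ s : ↥{s | (P g * w).IsRoot s}ᶜ, ∃ n, ∃ c : ℝ, c ≠ 0 ∧ X (v n) ≠ 0 ∧
      Y (v n) = s * X (v n) := by
    rintro ⟨s, hs⟩
    simp only [Set.mem_compl_iff, Set.mem_ofPred_eq, Polynomial.IsRoot.def, Polynomial.eval_mul,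
      mul_eq_zero, not_or] at hs
    obtain ⟨hs1, hs2⟩ := hs
    -- The value of `t` solving `t P + s w Q = 0` for `g` solves it for every `g'`.
    obtain ⟨n, c, hc⟩ := h.base (((-(s * w.eval s * (Q g).eval s) / (P g).eval s)) • v i +
        (1 * w.eval s) • v j + (1 * (s * w.eval s)) • v k + (1 * (-α * s)) • v m) (by
      intro g' hg'
      rw [hPQ g' hg']
      have h1 : (P g).eval s * (Q g').eval s - (P g').eval s * (Q g).eval s = 0 := by
        simpa using congrArg (Polynomial.eval s) (hD g g' hg hg')
      field_simp
      linear_combination 2 * s * w.eval s * h1)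
    have e1 : w.eval s = c * X (v n) := by simpa [Xi, Xj, Xk, Xm] using congrArg X hc
    have e2 : s * w.eval s = c * Y (v n) := by simpa [Yi, Yj, Yk, Ym] using congrArg Y hc
    have hc0 : c ≠ 0 := by
      rintro rfl
      simp [hs2] at e1
    refine ⟨n, c, hc0, ?_, ?_⟩
    · intro h0
      simp [h0, hs2] at e1
    · apply mul_left_cancel₀ hc0
      rw [← e2, e1]
      ring
  choose n c hc hXn hYn using hpt
  obtain ⟨s, s', hss, hnn⟩ := Finite.exists_ne_map_eq_of_infinite n
  apply hss
  have h1 := hYn s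
  rw [hnn, hYn s'] at h1
  exact Subtype.ext (mul_right_cancel₀ (hXn s') h1).symm

end IsBaseLocus

/-! ### Syzygies, and the quartics through the eight points. -/

/-- The product of two quadratic forms. -/
noncomputable def quadMul : Form 4 2 →ₗ[ℝ] Form 4 2 →ₗ[ℝ] Form 4 (2 * 2) := formMul

@[simp]
theorem evalAt_quadMul (f g : Form 4 2) (x : Fin 4 → ℝ) :
    evalAt x (quadMul f g) = evalAt x f * evalAt x g :=
  evalAt_formMul f g x

theorem coeff_eq_zero_of_forall {a b c d : ℝ}
    (h : ∀ s : ℝ, a * s + b * s ^ 2 + c * s ^ 3 + d * s ^ 4 = 0) : a = 0 ∧ b = 0 := by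
  have h1 := h 1
  have h2 := h (-1)
  have h3 := h 2
  have h4 := h (-2)
  constructor <;> linarith

namespace IsBaseLocus

variable {v : Fin 8 → Fin 4 → ℝ}

theorem mem_range_evalMap (h : IsBaseLocus v) {u : Fin 8 → ℝ} (hu : IsCayleyBacharach v u)
    {y : Fin 8 → ℝ} : y ∈ LinearMap.range (evalMap v 2) ↔ ∑ j, u j * y j = 0 := by
  constructor
  · rintro ⟨f, rfl⟩
    exact hu.2 f
  · intro hy
    by_contra hne
    obtain ⟨w, hw, hwy⟩ := exists_relation_of_notMem_range _ hne
    obtain ⟨c, rfl⟩ := h.relation_unique hu hw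
    apply hwy
    simp only [Pi.smul_apply, smul_eq_mul, mul_assoc]
    rw [← Finset.mul_sum, hy, mul_zero]

theorem finrank_ker_evalMap (h : IsBaseLocus v) :
    Module.finrank ℝ (LinearMap.ker (evalMap v 2)) = 3 := by
  obtain ⟨u, hu⟩ := h.exists_relation
  let φ : Module.Dual ℝ (Fin 8 → ℝ) := ∑ j, u j • LinearMap.proj j
  have hφ : ∀ y, φ y = ∑ j, u j * y j := fun y => by simp [φ]
  have hφ0 : φ ≠ 0 := by
    intro h0
    have h1 := hφ (Pi.single 0 1)
    rw [h0] at h1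
    simp [Pi.single_apply] at h1
    exact h.relation_ne_zero hu 0 h1.symm
  have hr : LinearMap.range (evalMap v 2) = LinearMap.ker φ := by
    ext y
    rw [h.mem_range_evalMap hu, LinearMap.mem_ker, hφ]
  have h1 := Module.Dual.finrank_ker_add_one_of_ne_zero hφ0
  have h2 := LinearMap.finrank_range_add_finrank_ker (evalMap v 2)
  rw [hr, finrank_form] at h2
  simp [Nat.multichoose_eq, Nat.choose] at h1 h2
  omega

/-- Two quadrics from `exists_six` with different exceptional points `j`, `k` multiply to a quartic
that is nonzero only at `v i`. -/
theorem range_evalMap_four (h : IsBaseLocus v) : LinearMap.range (evalMap v (2 * 2)) = ⊤ := by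
  refine surjective_of_forall_relation _ fun w hw => funext fun i => ?_
  obtain ⟨j, k, hij, hik, hjk⟩ : ∃ j k : Fin 8, i ≠ j ∧ i ≠ k ∧ j ≠ k := by
    clear hw
    revert i
    decide
  obtain ⟨f, hf, hfi⟩ := h.exists_six hij
  obtain ⟨g, hg, hgi⟩ := h.exists_six hik
  have h1 := hw (quadMul f g)
  simp only [evalMap_apply, evalAt_quadMul] at h1
  rw [Finset.sum_eq_single i] at h1
  · simpa [hfi, hgi] using h1
  · intro m _ hm
    by_cases hmj : m = j
    · rw [hg m hm (by rw [hmj]; exact hjk)]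
      simp
    · rw [hf m hm hmj]
      simp
  · simp

/-- Transversality: a dependence among the three differentials at `v j` would be a member of the net
singular there. -/
theorem exists_polar_eq (h : IsBaseLocus v) {b : Fin 3 → Form 4 2}
    (hb : ∀ t j, evalAt (v j) (b t) = 0) (hli : ∀ c : Fin 3 → ℝ, ∑ t, c t • b t = 0 → c = 0)
    (j : Fin 8) (e : Fin 3 → ℝ) : ∃ w, ∀ t, polar (b t) (v j) w = e t := by
  have hs : LinearMap.range (LinearMap.pi fun t => polar (b t) (v j)) = ⊤ := by
    refine surjective_of_forall_relation _ fun a ha => hli a ?_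
    refine h.eq_zero_of_singular (i := j) (fun m => by simp [hb]) (LinearMap.ext fun x => ?_)
    simpa using ha x
  obtain ⟨w, hw⟩ := LinearMap.range_eq_top.1 hs e
  exact ⟨w, fun t => congrFun hw t⟩

/-- Expand `∑ g_t b_t = 0` along `v j + s w`. The first-order term and transversality make each
`g_t` vanish at the points, so `g = c b` with a constant matrix `c`; the second-order term makes `c`
skew-symmetric. -/
theorem syzygy (h : IsBaseLocus v) {b : Fin 3 → Form 4 2}
    (hb : ∀ t j, evalAt (v j) (b t) = 0) (hli : ∀ c : Fin 3 → ℝ, ∑ t, c t • b t = 0 → c = 0)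
    (hK : ∀ k : Form 4 2, (∀ j, evalAt (v j) k = 0) → ∃ c : Fin 3 → ℝ, k = ∑ t, c t • b t)
    {g : Fin 3 → Form 4 2} (hg : ∑ t, quadMul (g t) (b t) = 0) :
    ∃ a : Fin 3 → ℝ, g 0 = a 0 • b 1 + a 1 • b 2 ∧ g 1 = -a 0 • b 0 + a 2 • b 2 ∧
      g 2 = -a 1 • b 0 + -a 2 • b 1 := by
  have hexp : ∀ j w, ∑ t, evalAt (v j) (g t) * polar (b t) (v j) w = 0 ∧
      ∑ t, (evalAt (v j) (g t) * evalAt w (b t) +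
        4 * (polar (g t) (v j) w * polar (b t) (v j) w)) = 0 := by
    intro j w
    have h1 : ∀ s : ℝ, ∑ t, evalAt (v j + s • w) (g t) * evalAt (v j + s • w) (b t) = 0 := by
      intro s
      simpa only [map_sum, evalAt_quadMul, map_zero] using congrArg (evalAt (v j + s • w)) hg
    have h2 := coeff_eq_zero_of_forall
      (a := 2 * ∑ t, evalAt (v j) (g t) * polar (b t) (v j) w)
      (b := ∑ t, (evalAt (v j) (g t) * evalAt w (b t) +
        4 * (polar (g t) (v j) w * polar (b t) (v j) w)))
      (c := ∑ t, (2 * polar (g t) (v j) w * evalAt w (b t) +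
        2 * evalAt w (g t) * polar (b t) (v j) w))
      (d := ∑ t, evalAt w (g t) * evalAt w (b t)) (fun s => by
        rw [← h1 s]
        simp only [Fin.sum_univ_three, evalAt_add, evalAt_smul, map_smul, smul_eq_mul, hb]
        ring)
    exact ⟨by linarith [h2.1], h2.2⟩
  have hg0 : ∀ t j, evalAt (v j) (g t) = 0 := by
    intro t j
    obtain ⟨w, hw⟩ := h.exists_polar_eq hb hli j (Pi.single t 1)
    have := (hexp j w).1
    simpa [hw, Pi.single_apply] using this
  choose c hc using fun t => hK (g t) (hg0 t)
  have hquad : ∀ e : Fin 3 → ℝ, ∑ t, (∑ m, c t m * e m) * e t = 0 := by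
    intro e
    obtain ⟨w, hw⟩ := h.exists_polar_eq hb hli 0 e
    have h1 := (hexp 0 w).2
    have h2 : ∀ t, polar (g t) (v 0) w = ∑ m, c t m * e m := by
      intro t
      rw [hc t]
      simp [hw]
    simp only [hg0, hw, h2, zero_mul, zero_add, ← Finset.mul_sum] at h1
    linarith
  have e0 := hquad ![1, 0, 0]
  have e1 := hquad ![0, 1, 0]
  have e2 := hquad ![0, 0, 1]
  have e3 := hquad ![1, 1, 0]
  have e4 := hquad ![1, 0, 1]
  have e5 := hquad ![0, 1, 1]
  simp [Fin.sum_univ_three] at e0 e1 e2 e3 e4 e5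
  refine ⟨![c 0 1, c 0 2, c 1 2], ?_, ?_, ?_⟩
  · rw [hc 0, Fin.sum_univ_three, e0]
    simp
  · have : c 1 0 = -c 0 1 := by linarith
    rw [hc 1, Fin.sum_univ_three, e1, this]
    simp
  · have h1 : c 2 0 = -c 0 2 := by linarith
    have h2 : c 2 1 = -c 1 2 := by linarith
    rw [hc 2, Fin.sum_univ_three, e2, h1, h2]
    simp

/-- The products `∑ g_t b_t` fill at least 30 - 3 = 27 dimensions, by `syzygy`, inside a kernel of
dimension 35 - 8 = 27. -/
theorem ker_evalMap_four_le (h : IsBaseLocus v) {S : Submodule ℝ (Form 4 (2 * 2))}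
    (hS : ∀ f g : Form 4 2, (∀ j, evalAt (v j) f = 0) → quadMul g f ∈ S) :
    LinearMap.ker (evalMap v (2 * 2)) ≤ S := by
  obtain ⟨b, hb, hK, hli⟩ := exists_basis_ker _ h.finrank_ker_evalMap
  replace hb : ∀ t j, evalAt (v j) (b t) = 0 := fun t j => congrFun (hb t) j
  replace hK : ∀ k : Form 4 2, (∀ j, evalAt (v j) k = 0) →
      ∃ c : Fin 3 → ℝ, k = ∑ t, c t • b t := fun k hk => hK k (funext hk)
  let Φ : (Fin 3 → Form 4 2) →ₗ[ℝ] Form 4 (2 * 2) :=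
    ∑ t, (quadMul.flip (b t)).comp (LinearMap.proj t)
  have hΦ : ∀ g, Φ g = ∑ t, quadMul (g t) (b t) := fun g => by simp [Φ]
  let Ψ : (Fin 3 → ℝ) →ₗ[ℝ] Fin 3 → Form 4 2 := LinearMap.pi
    ![(LinearMap.proj 0).smulRight (b 1) + (LinearMap.proj 1).smulRight (b 2),
      -(LinearMap.proj 0).smulRight (b 0) + (LinearMap.proj 2).smulRight (b 2),
      -(LinearMap.proj 1).smulRight (b 0) - (LinearMap.proj 2).smulRight (b 1)]
  have hker : LinearMap.ker Φ ≤ LinearMap.range Ψ := by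
    intro g hg
    rw [LinearMap.mem_ker, hΦ] at hg
    obtain ⟨a, h0, h1, h2⟩ := h.syzygy hb hli hK hg
    refine ⟨a, funext fun t => ?_⟩
    fin_cases t
    · simp [Ψ, h0]
    · simp [Ψ, h1]
      module
    · simp [Ψ, h2, sub_eq_add_neg]
      module
  have h1 : Module.finrank ℝ (LinearMap.ker Φ) ≤ 3 := by
    refine (Submodule.finrank_mono hker).trans ((LinearMap.finrank_range_le Ψ).trans ?_)
    simp
  have h2 := LinearMap.finrank_range_add_finrank_ker Φ
  have h3 := LinearMap.finrank_range_add_finrank_ker (evalMap v (2 * 2))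
  rw [h.range_evalMap_four, finrank_form, finrank_top] at h3
  rw [Module.finrank_pi_fintype] at h2
  simp only [finrank_form, Module.finrank_fin_fun, Finset.sum_const, Finset.card_univ,
    Fintype.card_fin, smul_eq_mul] at h2 h3
  rw [show Nat.multichoose 4 2 = 10 by simp [Nat.multichoose_eq, Nat.choose]] at h2
  rw [show Nat.multichoose 4 (2 * 2) = 35 by simp [Nat.multichoose_eq, Nat.choose]] at h3
  have hle : LinearMap.range Φ ≤ LinearMap.ker (evalMap v (2 * 2)) := by
    rintro _ ⟨g, rfl⟩
    rw [mem_ker_evalMap]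
    intro j
    simp only [hΦ, map_sum, evalAt_quadMul, hb, mul_zero, Finset.sum_const_zero]
  rw [← Submodule.eq_of_le_of_finrank_le hle (by omega)]
  rintro _ ⟨g, rfl⟩
  rw [hΦ]
  exact Submodule.sum_mem _ fun t _ => hS _ _ (hb t)

theorem exists_eq_sum_evalAt (h : IsBaseLocus v) {l : Module.Dual ℝ (Form 4 (2 * 2))}
    (hl : ∀ f g : Form 4 2, (∀ j, evalAt (v j) f = 0) → l (quadMul g f) = 0) :
    ∃ a : Fin 8 → ℝ, l = ∑ j, a j • evalAt (v j) := by
  have h1 := h.ker_evalMap_four_le (S := LinearMap.ker l) hl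
  have h2 : l ∈ Submodule.span ℝ (Set.range fun j => evalAt (d := 2 * 2) (v j)) := by
    refine mem_span_of_iInf_ker_le_ker fun f hf => h1 (mem_ker_evalMap.2 fun j => ?_)
    exact (Submodule.mem_iInf _).1 hf j
  obtain ⟨a, ha⟩ := (Submodule.mem_span_range_iff_exists_fun ℝ).1 h2
  exact ⟨a, ha.symm⟩

end IsBaseLocus

/-! ### The dual cone and its extreme rays. -/

theorem quadMul_comm (f g : Form 4 2) : quadMul f g = quadMul g f :=
  form_ext fun x => by rw [evalAt_quadMul, evalAt_quadMul, mul_comm]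

theorem quadMul_self_mem_sosCone (g : Form 4 2) : quadMul g g ∈ sosCone 4 2 :=
  ⟨1, fun _ => g, by simp [quadMul, formMul, pow_two]⟩

theorem mem_dualSosCone_iff {l : Module.Dual ℝ (Form 4 (2 * 2))} :
    l ∈ dualSosCone 4 2 ↔ ∀ g, 0 ≤ l (quadMul g g) := by
  refine ⟨fun h g => h _ (quadMul_self_mem_sosCone g), ?_⟩
  rintro h f ⟨r, g, hf⟩
  have : f = ∑ i, quadMul (g i) (g i) := by
    refine form_ext fun x => ?_
    rw [map_sum, evalAt_apply, hf]
    simp only [evalAt_quadMul, map_sum, pow_two, map_mul]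
    rfl
  rw [this, map_sum]
  exact Finset.sum_nonneg fun i _ => h _

theorem apply_quadMul_eq_zero {l : Module.Dual ℝ (Form 4 (2 * 2))} (hl : l ∈ dualSosCone 4 2)
    {f : Form 4 2} (hf : l (quadMul f f) = 0) (g : Form 4 2) : l (quadMul g f) = 0 := by
  by_contra hne
  have h := mem_dualSosCone_iff.1 hl
    -- The multiple of `f` is chosen so that `l` takes the value -1 on the square.
    (g + (-(l (quadMul g g) + 1) / (2 * l (quadMul g f))) • f)
  simp only [map_add, map_smul, LinearMap.add_apply, LinearMap.smul_apply, smul_eq_mul, hf,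
    quadMul_comm f g] at h
  set c := l (quadMul g f)
  have h1 : (-(l (quadMul g g) + 1) / (2 * c)) * c = -(l (quadMul g g) + 1) / 2 := by
    field_simp
  linarith

/-- Cauchy–Schwarz on the positive indices bounds `(u_n y_n)²` by `(-u_n² / a_n) ∑ a_i y_i²`. -/
theorem sum_mul_sq_nonneg {n : ℕ} {a u y : Fin (n + 1) → ℝ} (ha : ∀ i : Fin n, 0 < a i.castSucc)
    (hn : a (Fin.last n) < 0) (hu : u (Fin.last n) ≠ 0) (hau : ∑ j, u j ^ 2 / a j = 0)
    (hy : ∑ j, u j * y j = 0) : 0 ≤ ∑ j, a j * y j ^ 2 := by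
  rw [Fin.sum_univ_castSucc] at *
  have h := Finset.sum_sq_le_sum_mul_sum_of_sq_le_mul Finset.univ
    (r := fun i : Fin n => u i.castSucc * y i.castSucc)
    (f := fun i => u i.castSucc ^ 2 / a i.castSucc) (g := fun i => a i.castSucc * y i.castSucc ^ 2)
    (fun i _ => div_nonneg (sq_nonneg _) (ha i).le)
    (fun i _ => mul_nonneg (ha i).le (sq_nonneg _))
    (fun i _ => by refine le_of_eq ?_; have := (ha i).ne'; field_simp)
  rw [eq_neg_of_add_eq_zero_left hau, eq_neg_of_add_eq_zero_left hy] at h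
  set S := ∑ i : Fin n, a i.castSucc * y i.castSucc ^ 2
  have hu2 : 0 < u (Fin.last n) ^ 2 / -a (Fin.last n) :=
    div_pos (by positivity) (neg_pos.2 hn)
  refine (mul_nonneg_iff_of_pos_left hu2).1 ?_
  have e : u (Fin.last n) ^ 2 / -a (Fin.last n) * (S + a (Fin.last n) * y (Fin.last n) ^ 2)
      = -(u (Fin.last n) ^ 2 / a (Fin.last n)) * S - (-(u (Fin.last n) * y (Fin.last n))) ^ 2 := by
    have := hn.ne
    field_simp
    ring
  rw [e]
  linarith

namespace IsBaseLocus

variable {v : Fin 8 → Fin 4 → ℝ}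

theorem sum_smul_evalAt_apply (a : Fin 8 → ℝ) (f g : Form 4 2) :
    (∑ j, a j • evalAt (d := 2 * 2) (v j)) (quadMul f g)
      = ∑ j, a j * (evalAt (v j) f * evalAt (v j) g) := by
  simp only [LinearMap.sum_apply, LinearMap.smul_apply, evalAt_quadMul, smul_eq_mul]

theorem exists_nonneg_smul (h : IsBaseLocus v) {u : Fin 8 → ℝ} (hu : IsCayleyBacharach v u)
    {a : Fin 8 → ℝ} (ha : ∀ j, a j ≠ 0) (hau : ∑ j, u j ^ 2 / a j = 0)
    {g : Form 4 2} (hg : 0 < (∑ j, a j • evalAt (d := 2 * 2) (v j)) (quadMul g g))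
    {l₁ l₂ : Module.Dual ℝ (Form 4 (2 * 2))} (h₁ : l₁ ∈ dualSosCone 4 2)
    (h₂ : l₂ ∈ dualSosCone 4 2) (hl : l₁ + l₂ = ∑ j, a j • evalAt (v j)) :
    ∃ c : ℝ, 0 ≤ c ∧ l₁ = c • ∑ j, a j • evalAt (d := 2 * 2) (v j) := by
  have hker : ∀ f, (∑ j, a j • evalAt (d := 2 * 2) (v j)) (quadMul f f) = 0 →
      ∀ g, l₁ (quadMul g f) = 0 := by
    intro f hf
    rw [← hl, LinearMap.add_apply] at hf
    have e1 := mem_dualSosCone_iff.1 h₁ f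
    have e2 := mem_dualSosCone_iff.1 h₂ f
    exact apply_quadMul_eq_zero h₁ (by linarith)
  obtain ⟨b, rfl⟩ := h.exists_eq_sum_evalAt (l := l₁) fun f g hf => hker f (by
    simp only [sum_smul_evalAt_apply, hf, mul_zero, Finset.sum_const_zero]) g
  -- The isotropic quadric: by `hau` its prescribed values satisfy the Cayley–Bacharach relation,
  -- and its square is killed.
  obtain ⟨f, hf⟩ := (h.mem_range_evalMap hu (y := fun j => u j / a j)).2 (by
    rw [← hau]
    exact Finset.sum_congr rfl fun j _ => by ring)
  replace hf : ∀ j, evalAt (v j) f = u j / a j := fun j => congrFun hf j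
  have hrel := hker f (by
    rw [sum_smul_evalAt_apply, ← hau]
    refine Finset.sum_congr rfl fun j _ => ?_
    rw [hf]
    have := ha j
    field_simp)
  obtain ⟨c, hc⟩ := h.relation_unique (w := fun j => b j * (u j / a j)) hu fun g => by
    rw [← hrel g, sum_smul_evalAt_apply]
    refine Finset.sum_congr rfl fun j _ => ?_
    rw [hf]
    ring
  have hb : ∀ j, b j = c * a j := by
    intro j
    have h1 := congrFun hc j
    have h2 := h.relation_ne_zero hu j
    have h3 := ha j
    simp only [Pi.smul_apply, smul_eq_mul] at h1
    field_simp at h1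
    linarith
  have hbc : ∑ j, b j • evalAt (d := 2 * 2) (v j) = c • ∑ j, a j • evalAt (d := 2 * 2) (v j) := by
    rw [Finset.smul_sum]
    exact Finset.sum_congr rfl fun j _ => by rw [hb, mul_smul]
  refine ⟨c, ?_, hbc⟩
  have h1 := mem_dualSosCone_iff.1 h₁ g
  rw [hbc, LinearMap.smul_apply, smul_eq_mul] at h1
  exact nonneg_of_mul_nonneg_left h1 hg

theorem spansExtremeRay (h : IsBaseLocus v) {u : Fin 8 → ℝ} (hu : IsCayleyBacharach v u)
    {a : Fin 8 → ℝ} (ha : ∀ i : Fin 7, 0 < a i.castSucc) (ha7 : a (Fin.last 7) < 0)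
    (hau : ∑ j, u j ^ 2 / a j = 0) :
    SpansExtremeRay (dualSosCone 4 2) (∑ j, a j • evalAt (d := 2 * 2) (v j)) := by
  -- Supported on two points with positive weights, so the functional is positive on `g²`.
  obtain ⟨g, hg, hg0⟩ := h.exists_six (i := 0) (j := 1) (by decide)
  have hpos : 0 < (∑ j, a j • evalAt (d := 2 * 2) (v j)) (quadMul g g) := by
    rw [sum_smul_evalAt_apply]
    have h0 : 0 < a 0 := ha 0
    have h1 : 0 < a 1 := ha 1
    rw [Finset.sum_eq_add (0 : Fin 8) 1 (by decide) (fun j _ hj => by simp [hg j hj.1 hj.2])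
      (by simp) (by simp)]
    have h2 := mul_pos h0 (mul_self_pos.2 hg0)
    have h3 := mul_nonneg h1.le (mul_self_nonneg (evalAt (v 1) g))
    linarith
  have hne : ∀ j, a j ≠ 0 := Fin.lastCases ha7.ne fun i => (ha i).ne'
  refine ⟨mem_dualSosCone_iff.2 fun g => ?_, fun h0 => ?_, fun l₁ h₁ l₂ h₂ hl =>
    ⟨h.exists_nonneg_smul hu hne hau hpos h₁ h₂ hl,
      h.exists_nonneg_smul hu hne hau hpos h₂ h₁ (by rw [add_comm, hl])⟩⟩
  · rw [sum_smul_evalAt_apply]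
    simp only [← pow_two]
    exact sum_mul_sq_nonneg ha ha7 (h.relation_ne_zero hu _) hau (hu.2 g)
  · rw [h0] at hpos
    simp at hpos

/-- The `q i` themselves pass through the points, so the base locus of all quadrics through them is
no larger. -/
theorem of_projectivization {v : Fin 8 → Fin 4 → ℝ} (hv : ∀ j, v j ≠ 0)
    (hinj : Function.Injective fun j => Projectivization.mk ℝ (v j) (hv j))
    (hgen : NoFiveOnPlane v) {ι : Type*} (q : ι → Form 4 2)
    (hA : ⋂ i, realVariety (q i) = Set.range fun j => Projectivization.mk ℝ (v j) (hv j)) :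
    IsBaseLocus v where
  indep := by
    have key : ∀ i j, i ≠ j → ∀ a b : ℝ, a • v i + b • v j = 0 → a = 0 := by
      intro i j hij a b hab
      by_contra ha
      refine hij (hinj ((Projectivization.mk_eq_mk_iff' ℝ _ _ _ _).2 ⟨-b / a, ?_⟩))
      have h1 : a • v i = -b • v j := by rw [eq_neg_of_add_eq_zero_left hab, neg_smul]
      rw [div_eq_inv_mul, mul_smul, ← h1, smul_smul, inv_mul_cancel₀ ha, one_smul]
    exact fun i j hij a b hab => ⟨key i j hij a b hab, key j i hij.symm b a (by rw [add_comm, hab])⟩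
  generic := hgen
  base := by
    intro x hx
    by_cases hx0 : x = 0
    · exact ⟨0, 0, by simp [hx0]⟩
    have hq : ∀ i j, evalAt (v j) (q i) = 0 := by
      intro i j
      have h1 : Projectivization.mk ℝ (v j) (hv j) ∈ ⋂ i, realVariety (q i) := by
        rw [hA]
        exact ⟨j, rfl⟩
      refine Set.mem_iInter.1 h1 i (v j) ?_
      rw [Projectivization.submodule_mk]
      exact Submodule.mem_span_singleton_self _
    have h2 : Projectivization.mk ℝ x hx0 ∈ ⋂ i, realVariety (q i) := by
      refine Set.mem_iInter.2 fun i y hy => ?_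
      rw [Projectivization.submodule_mk] at hy
      obtain ⟨c, rfl⟩ := Submodule.mem_span_singleton.1 hy
      rw [evalAt_smul, hx _ (hq i), mul_zero]
    rw [hA] at h2
    obtain ⟨j, hj⟩ := h2
    obtain ⟨c, hc⟩ := (Projectivization.mk_eq_mk_iff' ℝ _ _ _ _).1 hj.symm
    exact ⟨j, c, hc.symm⟩

end IsBaseLocus

/-! ### Choice of the weights and the main theorem. -/

theorem sum_fin_eight_eq {k : ℕ} (hk : k ≤ 7) (F : Fin 8 → ℝ) :
    ∑ j, F j = (∑ j : Fin 8 with j.val < k, F j) +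
      (∑ j : Fin 8 with k ≤ j.val ∧ j.val < 7, F j) + F 7 := by
  rw [← Finset.sum_filter_add_sum_filter_not Finset.univ (fun j : Fin 8 => j.val < k), add_assoc]
  congr 1
  have : (Finset.univ.filter fun j : Fin 8 => ¬ j.val < k)
      = insert 7 (Finset.univ.filter fun j : Fin 8 => k ≤ j.val ∧ j.val < 7) := by
    ext j
    simp only [Finset.mem_filter, Finset.mem_univ, true_and, Finset.mem_insert, Fin.ext_iff]
    have := j.2
    change _ ↔ j.val = 7 ∨ _
    omega
  rw [this, Finset.sum_insert (by simp), add_comm]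

theorem theorem3p2
    -- a nonnegative quaternary quartic on the boundary of `P_{4,4}`, not a sum of squares
    (p : Form 4 (2 * 2)) (hp : p ∈ psdCone 4 2) (hbd : p ∈ frontier (psdCone 4 2))
    (hsos : p ∉ sosCone 4 2)
    -- representatives of eight distinct points of real projective 3-space (index `j` is `v_{j+1}`)
    (v : Fin 8 → Fin 4 → ℝ) (hv : ∀ j, v j ≠ 0)
    (hinj : Function.Injective fun j => Projectivization.mk ℝ (v j) (hv j))
    (hgen : NoFiveOnPlane v)
    -- these eight points are the intersection of three coprime quadrics
    (q : Fin 3 → Form 4 2) (hq : CoprimeForms q)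
    (hA : ⋂ i, realVariety (q i) = Set.range fun j => Projectivization.mk ℝ (v j) (hv j))
    -- the zeros of `p` are exactly the first `k` of them
    (k : ℕ) (hk1 : 1 ≤ k) (hk7 : k ≤ 7)
    (hzero : realVariety p =
      (fun j => Projectivization.mk ℝ (v j) (hv j)) '' {j : Fin 8 | j.val < k}) :
    -- there is a Cayley-Bacharach relation, unique up to scaling, with nonzero coefficients
    (∃ u : Fin 8 → ℝ, IsCayleyBacharach v u ∧ (∀ j, u j ≠ 0) ∧
      ∀ w : Fin 8 → ℝ, IsCayleyBacharach v w → ∃ c : ℝ, w = c • u) ∧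
    -- and the inequality for it yields a separating extreme ray supported on the eight points
    ∀ u : Fin 8 → ℝ, IsCayleyBacharach v u →
      (∑ j : Fin 8 with k ≤ j.val ∧ j.val < 7, u j ^ 2) *
          (∑ j : Fin 8 with k ≤ j.val ∧ j.val < 7, evalAt (v j) p) <
        u 7 ^ 2 * evalAt (v 7) p →
      ∃ a : Fin 8 → ℝ,
        (∑ j, a j • evalAt (d := 2 * 2) (v j)) p < 0 ∧
        SpansExtremeRay (dualSosCone 4 2) (∑ j, a j • evalAt (d := 2 * 2) (v j)) := by
  have h := IsBaseLocus.of_projectivization hv hinj hgen q hA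
  obtain ⟨u₀, hu₀⟩ := h.exists_relation
  refine ⟨⟨u₀, hu₀, h.relation_ne_zero hu₀, fun w hw => h.relation_unique hu₀ hw.2⟩, ?_⟩
  intro u hu hlt
  have hp0 : ∀ j : Fin 8, j.val < k → evalAt (v j) p = 0 := by
    intro j hj
    have h1 : Projectivization.mk ℝ (v j) (hv j) ∈ realVariety p := by
      rw [hzero]
      exact ⟨j, hj, rfl⟩
    refine h1 (v j) ?_
    rw [Projectivization.submodule_mk]
    exact Submodule.mem_span_singleton_self _
  set U := ∑ j : Fin 8 with k ≤ j.val ∧ j.val < 7, u j ^ 2 with hU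
  set R := ∑ j : Fin 8 with k ≤ j.val ∧ j.val < 7, evalAt (v j) p with hR
  set T := ∑ j : Fin 8 with j.val < k, u j ^ 2 with hT
  have hU0 : 0 ≤ U := Finset.sum_nonneg fun j _ => sq_nonneg _
  have hR0 : 0 ≤ R := Finset.sum_nonneg fun j _ => hp (v j)
  have hT0 : 0 < T := by
    refine Finset.sum_pos (fun j _ => ?_) ⟨0, by simpa using Nat.pos_of_ne_zero (by omega)⟩
    have := h.relation_ne_zero hu j
    positivity
  have hu7 : 0 < u 7 ^ 2 := by
    have := h.relation_ne_zero hu 7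
    positivity
  set s₀ := U / u 7 ^ 2 with hs₀
  have hs₀0 : 0 ≤ s₀ := div_nonneg hU0 hu7.le
  have hD : 0 < evalAt (v 7) p - s₀ * R := by
    rw [sub_pos, hs₀, div_mul_eq_mul_div, div_lt_iff₀ hu7]
    linarith
  -- The hypothesis says `s₀ R < p(v 7)`. The bound `s > s₀` leaves `ε > 0`, and `s R < p(v 7)`
  -- gives separation; `R + 1` in the witness covers `R = 0`.
  obtain ⟨s, hs, hsR⟩ : ∃ s, s₀ < s ∧ s * R < evalAt (v 7) p := by
    refine ⟨s₀ + (evalAt (v 7) p - s₀ * R) / (R + 1), by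
      have : 0 < (evalAt (v 7) p - s₀ * R) / (R + 1) := by positivity
      linarith, ?_⟩
    have h1 : (evalAt (v 7) p - s₀ * R) / (R + 1) * R < evalAt (v 7) p - s₀ * R := by
      rw [div_mul_eq_mul_div, div_lt_iff₀ (by linarith)]
      linarith
    linarith
  have hs0 : 0 < s := hs₀0.trans_lt hs
  set ε := u 7 ^ 2 - U / s with hε
  have hε0 : 0 < ε := by
    rw [hε, sub_pos, div_lt_iff₀ hs0]
    rw [hs₀, div_lt_iff₀ hu7] at hs
    linarith
  -- With weights `T / ε`, `s`, `-1` the sum `∑ u_j² / a_j` is `ε + U / s - u_7² = 0`. The first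
  -- weight does not affect the value at `p`, which is `s R - p(v 7)`.
  let a : Fin 8 → ℝ := fun j => if j.val < k then T / ε else if j.val < 7 then s else -1
  have ha1 : ∀ j ∈ Finset.univ.filter (fun j : Fin 8 => j.val < k), a j = T / ε := by
    intro j hj
    simp only [Finset.mem_filter, Finset.mem_univ, true_and] at hj
    simp [a, hj]
  have ha2 : ∀ j ∈ Finset.univ.filter (fun j : Fin 8 => k ≤ j.val ∧ j.val < 7), a j = s := by
    intro j hj
    simp only [Finset.mem_filter, Finset.mem_univ, true_and] at hj
    simp [a, hj.2, not_lt.2 hj.1]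
  have ha7 : a 7 = -1 := by
    have : ¬ ((7 : Fin 8).val < k) := not_lt.2 hk7
    simp only [a, if_neg this]
    simp
  refine ⟨a, ?_, h.spansExtremeRay hu (fun i => ?_) ?_ ?_⟩
  · rw [LinearMap.sum_apply, sum_fin_eight_eq hk7]
    simp only [LinearMap.smul_apply, smul_eq_mul, ha7]
    rw [Finset.sum_eq_zero fun j hj => by rw [hp0 j (by simpa using hj), mul_zero],
      Finset.sum_congr rfl fun j hj => by rw [ha2 j hj], ← Finset.mul_sum, ← hR]
    linarith
  · have : (i.castSucc).val < 7 := i.2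
    simp only [a, this, if_true]
    split_ifs
    · positivity
    · exact hs0
  · rw [show Fin.last 7 = (7 : Fin 8) from rfl, ha7]
    norm_num
  · rw [sum_fin_eight_eq hk7, ha7, Finset.sum_congr rfl fun j hj => by rw [ha1 j hj],
      Finset.sum_congr (s₁ := Finset.univ.filter fun j : Fin 8 => k ≤ j.val ∧ j.val < 7) rfl
        fun j hj => by rw [ha2 j hj], ← Finset.sum_div, ← Finset.sum_div, ← hT, ← hU, hε]
    field_simp
    ring
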